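/- Equip $\mathbb{C}^n$ with its standard Hermitian norm. A \emph{convex body} in $\mathbb{C}^n$ is a compact convex subset with non-empty interior. A \emph{complex ellipsoid} in $\mathbb{C}^n$ is the image of a closed ball of positive radius under an invertible complex affine transformation of $\mathbb{C}^n$. A \emph{complex line} is a complex affine subspace $L\subset\mathbb{C}^n$ of complex dimension one, and a \emph{disk} in $L$ is a set of the form $\{x\in L : \|x-c\|\le r\}$ with $c\in L$ and $r>0$. \textbf{Theorem.} A convex body $K\subset\mathbb{C}^n$ is a complex ellipsoid if and only if, for every complex line $L\subset\mathbb{C}^n$, the intersection $L\cap K$ is either empty, a single point, or a disk in $L$. -/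

import Mathlib

/-- A complex ellipsoid in `ℂⁿ`: the image of a closed Euclidean ball of positive radius under an
(invertible) complex affine transformation of `ℂⁿ`. -/
def IsComplexEllipsoid {n : ℕ} (K : Set (EuclideanSpace ℂ (Fin n))) : Prop :=
  ∃ (f : EuclideanSpace ℂ (Fin n) ≃ᵃ[ℂ] EuclideanSpace ℂ (Fin n))
    (c : EuclideanSpace ℂ (Fin n)) (r : ℝ), 0 < r ∧ K = f '' Metric.closedBall c r

/-- A complex affine line in `ℂⁿ`: a complex affine subspace of complex dimension one. -/
def IsComplexLine {n : ℕ} (L : AffineSubspace ℂ (EuclideanSpace ℂ (Fin n))) : Prop :=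
  Module.finrank ℂ L.direction = 1

/-- `D` is a (closed, round) disk of the complex line `L`: the set of points of `L` at Euclidean
distance at most `r` from `c`, for some point `c` of `L` and some radius `r > 0`. -/
def IsDiskIn {n : ℕ} (L : AffineSubspace ℂ (EuclideanSpace ℂ (Fin n)))
    (D : Set (EuclideanSpace ℂ (Fin n))) : Prop :=
  ∃ c ∈ L, ∃ r : ℝ, 0 < r ∧ D = {x | x ∈ L ∧ dist x c ≤ r}

open Metric
open scoped InnerProductSpace ComplexConjugate

/-! Balls have disk sections by Pythagoras, and complex affine maps act on each line by
similarities, so ellipsoids have disk sections too.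

Conversely, an affine change of coordinates makes the unit ball the ellipsoid of least volume
containing `K`. Let `C` be the set of contact points of `K` with the unit sphere. A line through two
points of `C` cuts `K` and the ball in nested disks whose boundary circles share two points; the
disks coincide, so the whole circle (a chain) lies in `C`. Hence `C` is chain-closed. Minimality
keeps `C` out of every complex affine hyperplane (`UnitBallIsMinimal.exists_contact`): otherwise a
stretch normal to the hyperplane followed by a slight shrinking gives a smaller ellipsoid. Finally,
the directions of the chains in `C` through a fixed point form a complex affine subspace; if it were
proper, `C` would lie in a hyperplane, so `C` is the whole sphere (`IsChainClosed.sphere_subset`).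
By convexity `K` is the ball. -/

/-- Two nested disks whose boundaries share two points are equal. -/
theorem closedBall_eq_of_subset_of_two_contacts {c c' x y : ℂ} {ρ ρ' : ℝ}
    (hsub : closedBall c ρ ⊆ closedBall c' ρ') (hx : dist x c ≤ ρ) (hx' : dist x c' = ρ')
    (hy : dist y c ≤ ρ) (hy' : dist y c' = ρ') (hxy : x ≠ y) :
    closedBall c ρ = closedBall c' ρ' := by
  by_cases hc : c = c'
  · subst hc
    exact hsub.antisymm (closedBall_subset_closedBall (hx' ▸ hx))
  exfalso
  have hρ : 0 ≤ ρ := dist_nonneg.trans hx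
  have hδ : 0 < ‖c - c'‖ := norm_pos_iff.2 (sub_ne_zero.2 hc)
  have hfar : ρ + ‖c - c'‖ ≤ ρ' := by
    -- The point of the inner disk farthest from `c'`.
    have hz : c + ((ρ / ‖c - c'‖ : ℝ) : ℂ) * (c - c') ∈ closedBall c ρ := by
      rw [mem_closedBall, dist_eq_norm, add_sub_cancel_left, norm_mul, Complex.norm_real,
        Real.norm_of_nonneg (by positivity), div_mul_cancel₀ _ hδ.ne']
    have hz' := hsub hz
    rw [mem_closedBall, dist_eq_norm,
      show c + ((ρ / ‖c - c'‖ : ℝ) : ℂ) * (c - c') - c'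
        = ((ρ / ‖c - c'‖ + 1 : ℝ) : ℂ) * (c - c') by push_cast; ring,
      norm_mul, Complex.norm_real, Real.norm_of_nonneg (by positivity), add_mul,
      div_mul_cancel₀ _ hδ.ne', one_mul] at hz'
    exact hz'
  -- Equality in the triangle inequality forces `z - c` onto the ray of `c - c'`, so the contact
  -- point is unique.
  have key : ∀ z : ℂ, dist z c ≤ ρ → dist z c' = ρ' →
      ρ • (c - c') = ‖c - c'‖ • (z - c) := by
    intro z hz hz'
    rw [dist_eq_norm] at hz hz'
    have hsum : z - c' = (z - c) + (c - c') := by ring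
    have htri := norm_add_le (z - c) (c - c')
    rw [← hsum] at htri
    have hzρ : ‖z - c‖ = ρ := by linarith
    have hray : SameRay ℝ (z - c) (c - c') :=
      sameRay_iff_norm_add.2 (by rw [← hsum]; linarith)
    rw [← hzρ]
    exact hray.norm_smul_eq
  have h := (key x hx hx').symm.trans (key y hy hy')
  exact hxy (sub_left_injective (smul_right_injective ℂ hδ.ne' h))

/-! ### Sections of balls by complex lines -/

section InnerProduct

variable {V : Type*} [NormedAddCommGroup V] [InnerProductSpace ℂ V]

theorem exists_norm_add_smul_sq_eq (u : V) {d : V} (hd : d ≠ 0) :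
    ∃ (l : ℂ) (m : ℝ), ∀ z : ℂ, ‖u + z • d‖ ^ 2 = ‖d‖ ^ 2 * ‖z - l‖ ^ 2 + m := by
  have hd' : ⟪d, d⟫_ℂ ≠ 0 := inner_self_ne_zero.2 hd
  set l : ℂ := -⟪d, u⟫_ℂ / ⟪d, d⟫_ℂ with hl
  refine ⟨l, ‖u + l • d‖ ^ 2, fun z => ?_⟩
  have horth : ⟪(z - l) • d, u + l • d⟫_ℂ = 0 := by
    rw [inner_smul_left, inner_add_right, inner_smul_right, hl, div_mul_cancel₀ _ hd']
    ring
  have := norm_add_sq_eq_norm_sq_add_norm_sq_of_inner_eq_zero _ _ horth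
  rw [show u + z • d = (z - l) • d + (u + l • d) by module, sq, this, norm_smul]
  ring

/-- A complex line through the point `u` of a ball centred at `0` meets that ball in a disk. -/
theorem exists_norm_add_smul_le_iff {u d : V} (hd : d ≠ 0) {r : ℝ} (hu : ‖u‖ ≤ r) :
    ∃ (l : ℂ) (ρ : ℝ), (∀ z : ℂ, ‖u + z • d‖ ≤ r ↔ dist z l ≤ ρ) ∧
      ∀ z : ℂ, ‖u + z • d‖ = r ↔ dist z l = ρ := by
  obtain ⟨l, m, h⟩ := exists_norm_add_smul_sq_eq u hd
  have hr : 0 ≤ r := (norm_nonneg u).trans hu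
  have hdp : 0 < ‖d‖ ^ 2 := by positivity
  have h0 := h 0
  rw [zero_smul, add_zero] at h0
  have hm : 0 ≤ (r ^ 2 - m) / ‖d‖ ^ 2 := by
    have : ‖u‖ ^ 2 ≤ r ^ 2 := by gcongr
    have : 0 ≤ ‖d‖ ^ 2 * ‖0 - l‖ ^ 2 := by positivity
    apply div_nonneg _ hdp.le
    linarith
  refine ⟨l, √((r ^ 2 - m) / ‖d‖ ^ 2), fun z => ?_, fun z => ?_⟩
  · rw [dist_eq_norm, ← sq_le_sq₀ (norm_nonneg _) hr, h, Real.le_sqrt (norm_nonneg _) hm,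
      le_div_iff₀ hdp, mul_comm, le_sub_iff_add_le]
  · rw [dist_eq_norm, ← sq_eq_sq₀ (norm_nonneg _) hr, h,
      ← sq_eq_sq₀ (norm_nonneg _) (Real.sqrt_nonneg _), Real.sq_sqrt hm, eq_div_iff hdp.ne',
      mul_comm, eq_sub_iff_add_eq]

/-- Every complex line through two points of `K` meets `K` in a disk. -/
def HasDiskSections (K : Set V) : Prop :=
  ∀ p ∈ K, ∀ q ∈ K, p ≠ q → ∃ (l : ℂ) (ρ : ℝ), ∀ z : ℂ, p + z • (q - p) ∈ K ↔ dist z l ≤ ρ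

theorem HasDiskSections.mem_of_norm_eq_one {K : Set V} (hK : HasDiskSections K)
    (hsub : K ⊆ closedBall 0 1) {p q : V} (hp : p ∈ K) (hp1 : ‖p‖ = 1) (hq : q ∈ K)
    (hq1 : ‖q‖ = 1) {z : ℂ} (hz : ‖p + z • (q - p)‖ = 1) : p + z • (q - p) ∈ K := by
  by_cases hpq : p = q
  · subst hpq
    simpa using hp
  obtain ⟨l, ρ, h⟩ := hK p hp q hq hpq
  obtain ⟨l', ρ', h1, h2⟩ := exists_norm_add_smul_le_iff (sub_ne_zero.2 (Ne.symm hpq)) hp1.le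
  have h0 : p + (0 : ℂ) • (q - p) = p := by simp
  have h1' : p + (1 : ℂ) • (q - p) = q := by simp
  have heq := closedBall_eq_of_subset_of_two_contacts (c := l) (ρ := ρ) (c' := l') (ρ' := ρ')
    (x := 0) (y := 1) (fun w hw => (h1 w).1 (by simpa using hsub ((h w).2 hw)))
    ((h 0).1 (by rwa [h0])) ((h2 0).1 (by rwa [h0])) ((h 1).1 (by rwa [h1']))
    ((h2 1).1 (by rwa [h1'])) zero_ne_one
  rw [h, ← mem_closedBall, heq, mem_closedBall, ← h1]
  exact hz.le

/-! ### Chains on the unit sphere -/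

/-- Direction vectors, normalised by `⟪r, v⟫ = -1`, of the complex lines through `r` whose
intersection with the unit sphere is contained in `C`. -/
def chainDirections (C : Set V) (r : V) : Set V :=
  {v | ⟪r, v⟫_ℂ = -1 ∧ ∀ m : ℂ, 2 * m.re = ‖v‖ ^ 2 → r + m⁻¹ • v ∈ C}

/-- Inverting the parameter turns the chain, minus `r`, into a vertical line in the `m`-plane. -/
theorem norm_add_inv_smul_eq_one_iff {r v : V} (hr : ‖r‖ = 1) (hv : ⟪r, v⟫_ℂ = -1) {m : ℂ}
    (hm : m ≠ 0) : ‖r + m⁻¹ • v‖ = 1 ↔ 2 * m.re = ‖v‖ ^ 2 := by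
  have hm' : 0 < Complex.normSq m := Complex.normSq_pos.2 hm
  rw [← sq_eq_sq₀ (norm_nonneg _) zero_le_one, norm_add_sq (𝕜 := ℂ), inner_smul_right, hv, hr,
    norm_smul, mul_pow, norm_inv, inv_pow, ← Complex.normSq_eq_norm_sq]
  simp only [RCLike.re_to_complex, mul_neg, mul_one, Complex.neg_re, Complex.inv_re]
  field_simp
  constructor <;> intro h <;> linarith

theorem ne_zero_of_two_mul_re_eq {r v : V} (hv : ⟪r, v⟫_ℂ = -1) {m : ℂ}
    (hm : 2 * m.re = ‖v‖ ^ 2) : m ≠ 0 := by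
  rintro rfl
  have : v = 0 := by simpa using hm.symm
  simp [this] at hv

/-- Closure of `C` under complex lines, relative to the unit sphere. -/
def IsChainClosed (C : Set V) : Prop :=
  ∀ p ∈ C, ∀ q ∈ C, ∀ z : ℂ, ‖p + z • (q - p)‖ = 1 → p + z • (q - p) ∈ C

/-- If `m = (1 - s) a + s b`, the point with parameter `m` on the new chain is collinear with the
points with parameters `a` and `b` on the chains of `v` and `w`. The real parts of `a` and `b` are
prescribed and their imaginary parts are free: two real equations in two unknowns, solvable because
`s` is not real. -/
theorem mem_chainDirections_of_nonreal {C : Set V} (hC : IsChainClosed C) {r : V}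
    (hr : ‖r‖ = 1) {v w : V} (hv : v ∈ chainDirections C r) (hw : w ∈ chainDirections C r)
    {s : ℂ} (hs : s.im ≠ 0) : v + s • (w - v) ∈ chainDirections C r := by
  have hin : ⟪r, v + s • (w - v)⟫_ℂ = -1 := by
    rw [inner_add_right, inner_smul_right, inner_sub_right, hv.1, hw.1]
    ring
  refine ⟨hin, fun m hm => ?_⟩
  have hm0 : m ≠ 0 := ne_zero_of_two_mul_re_eq hin hm
  have hnorm := (norm_add_inv_smul_eq_one_iff hr hin hm0).2 hm
  obtain ⟨a, b, ha, hb, hab⟩ : ∃ a b : ℂ, 2 * a.re = ‖v‖ ^ 2 ∧ 2 * b.re = ‖w‖ ^ 2 ∧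
      (1 - s) * a + s * b = m := by
    set A := ‖v‖ ^ 2 / 2 with hA
    set B := ‖w‖ ^ 2 / 2 with hB
    -- `t` is `b.im - a.im`, forced by the real part of the equation; the imaginary part then gives
    -- `y = a.im`.
    set t := ((1 - s.re) * A + s.re * B - m.re) / s.im with ht
    have ht' : t * s.im = (1 - s.re) * A + s.re * B - m.re := div_mul_cancel₀ _ hs
    set y := m.im - s.re * t - s.im * (B - A) with hy
    refine ⟨⟨A, y⟩, ⟨B, y + t⟩, by simp only [hA]; ring, by simp only [hB]; ring, ?_⟩
    apply Complex.ext
    · simp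
      linarith
    · simp
      linarith
  have ha0 := ne_zero_of_two_mul_re_eq hv.1 ha
  have hb0 := ne_zero_of_two_mul_re_eq hw.1 hb
  have heq : r + m⁻¹ • (v + s • (w - v))
      = (r + a⁻¹ • v) + (s * b / m) • ((r + b⁻¹ • w) - (r + a⁻¹ • v)) := by
    have h1 : s * b / m * b⁻¹ = m⁻¹ * s := by field_simp
    have h2 : a⁻¹ - s * b / m * a⁻¹ = m⁻¹ * (1 - s) := by
      field_simp
      linear_combination -hab
    calc r + m⁻¹ • (v + s • (w - v)) = r + (m⁻¹ * (1 - s)) • v + (m⁻¹ * s) • w := by module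
      _ = r + (a⁻¹ - s * b / m * a⁻¹) • v + (s * b / m * b⁻¹) • w := by rw [h1, h2]
      _ = _ := by module
  rw [heq] at hnorm ⊢
  exact hC _ (hv.2 a ha) _ (hw.2 b hb) _ hnorm

theorem mem_chainDirections {C : Set V} (hC : IsChainClosed C) {r : V}
    (hr : ‖r‖ = 1) {v w : V} (hv : v ∈ chainDirections C r) (hw : w ∈ chainDirections C r)
    (s : ℂ) : v + s • (w - v) ∈ chainDirections C r := by
  by_cases hs : s.im = 0
  · by_cases hs0 : s = 0
    · simpa [hs0] using hv
    have hre : s.re ≠ 0 := fun h => hs0 (Complex.ext h hs)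
    -- A nonzero real `s` is the product of the nonreal factors `I` and `-I * s`.
    have h1 := mem_chainDirections_of_nonreal hC hr hv hw (s := Complex.I) (by simp)
    have h2 := mem_chainDirections_of_nonreal hC hr hv h1 (s := -Complex.I * s) (by simpa)
    convert h2 using 2
    rw [add_sub_cancel_left, smul_smul]
    congr 1
    linear_combination s * Complex.I_sq
  · exact mem_chainDirections_of_nonreal hC hr hv hw hs

/-- The directions from a point of a chain-closed set form a complex affine subspace. -/
def chainDirectionSubmodule {C : Set V} (hC : IsChainClosed C) {r : V}
    (hr : ‖r‖ = 1) {v : V} (hv : v ∈ chainDirections C r) : Submodule ℂ V where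
  carrier := {d | v + d ∈ chainDirections C r}
  zero_mem' := by simpa using hv
  smul_mem' s d hd := by
    simpa using mem_chainDirections hC hr hv hd s
  add_mem' {d e} hd he := by
    have hd2 := mem_chainDirections hC hr hv hd 2
    have he2 := mem_chainDirections hC hr hv he 2
    have h := mem_chainDirections hC hr hd2 he2 (1 / 2)
    rwa [show v + (2 : ℂ) • (v + d - v) + (1 / 2 : ℂ) • (v + (2 : ℂ) • (v + e - v)
      - (v + (2 : ℂ) • (v + d - v))) = v + (d + e) by module] at h

theorem mem_chainDirectionSubmodule {C : Set V} (hC : IsChainClosed C) {r : V}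
    (hr : ‖r‖ = 1) {v : V} (hv : v ∈ chainDirections C r) {d : V} :
    d ∈ chainDirectionSubmodule hC hr hv ↔ v + d ∈ chainDirections C r := Iff.rfl

theorem inner_sub_ne_zero_of_norm_eq_one {r x : V} (hr : ‖r‖ = 1) (hx : ‖x‖ = 1) (h : x ≠ r) :
    1 - ⟪r, x⟫_ℂ ≠ 0 := fun h0 =>
  h ((inner_eq_one_iff_of_norm_eq_one (𝕜 := ℂ) hr hx).1 (sub_eq_zero.1 h0).symm).symm

/-- The normalised direction of the line through `r` and `x`. -/
theorem exists_chainDirection {r x : V} (hr : ‖r‖ = 1) (hx : ‖x‖ = 1) (h : x ≠ r) :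
    ∃ v : V, ⟪r, v⟫_ℂ = -1 ∧ x = r + (1 - ⟪r, x⟫_ℂ) • v := by
  have h0 := inner_sub_ne_zero_of_norm_eq_one hr hx h
  refine ⟨(1 - ⟪r, x⟫_ℂ)⁻¹ • (x - r), ?_, ?_⟩
  · rw [inner_smul_right, inner_sub_right, inner_self_eq_norm_sq_to_K, hr]
    field_simp
    simp
  · rw [smul_smul, mul_inv_cancel₀ h0, one_smul, add_sub_cancel]

theorem mem_chainDirections_of_mem {C : Set V} (hC : IsChainClosed C) {r x v : V}
    (hr : ‖r‖ = 1) (hrC : r ∈ C) (hxC : x ∈ C) (hxr : x ≠ r) (hv : ⟪r, v⟫_ℂ = -1) {k : ℂ}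
    (hxv : x = r + k • v) : v ∈ chainDirections C r := by
  have hk : k ≠ 0 := by
    rintro rfl
    exact hxr (by simpa using hxv)
  refine ⟨hv, fun m hm => ?_⟩
  have hnorm := (norm_add_inv_smul_eq_one_iff hr hv (ne_zero_of_two_mul_re_eq hv hm)).2 hm
  have heq : r + m⁻¹ • v = r + (m⁻¹ * k⁻¹) • (x - r) := by
    rw [hxv, add_sub_cancel_left, smul_smul, mul_assoc, inv_mul_cancel₀ hk, mul_one]
  rw [heq] at hnorm ⊢
  exact hC _ hrC _ hxC _ hnorm

/-- A chain-closed subset of the unit sphere not contained in a complex affine hyperplane is the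
whole sphere. -/
theorem IsChainClosed.sphere_subset [FiniteDimensional ℂ V] {C : Set V} (hC : IsChainClosed C)
    (hsub : C ⊆ sphere 0 1) (hspan : ∀ e : V, e ≠ 0 → ∀ k : ℂ, ∃ p ∈ C, ⟪e, p⟫_ℂ ≠ k)
    (hne : C.Nonempty) : sphere 0 1 ⊆ C := by
  obtain ⟨r, hrC⟩ := hne
  have hr : ‖r‖ = 1 := by simpa using hsub hrC
  have hr0 : r ≠ 0 := by
    rintro rfl
    simp at hr
  have hrr : ⟪r, r⟫_ℂ = 1 := by rw [inner_self_eq_norm_sq_to_K, hr]; simp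
  intro x hx
  have hx1 : ‖x‖ = 1 := by simpa using hx
  by_contra hxC
  have hxr : x ≠ r := fun h => hxC (h ▸ hrC)
  -- The hyperplane `⟪r, ·⟫ = 1` contains `r`, so avoiding it yields a second point of `C`.
  obtain ⟨q, hqC, hqr'⟩ := hspan r hr0 1
  have hqr : q ≠ r := by
    rintro rfl
    exact hqr' hrr
  obtain ⟨v, hv, hqv⟩ := exists_chainDirection hr (by simpa using hsub hqC) hqr
  have hvD := mem_chainDirections_of_mem hC hr hrC hqC hqr hv hqv
  obtain ⟨w, hw, hxw⟩ := exists_chainDirection hr hx1 hxr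
  have hk0 := inner_sub_ne_zero_of_norm_eq_one hr hx1 hxr
  set N := chainDirectionSubmodule hC hr hvD with hN
  have hwN : w - v ∉ N := by
    intro h
    rw [hN, mem_chainDirectionSubmodule, add_sub_cancel] at h
    refine hxC ?_
    have hnorm : ‖r + (1 - ⟪r, x⟫_ℂ)⁻¹⁻¹ • w‖ = 1 := by rw [inv_inv, ← hxw, hx1]
    have := h.2 _ ((norm_add_inv_smul_eq_one_iff hr hw (inv_ne_zero hk0)).1 hnorm)
    rwa [inv_inv, ← hxw] at this
  obtain ⟨f, hf, hfN⟩ := Submodule.exists_le_ker_of_notMem hwN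
  obtain ⟨u, hu⟩ : ∃ u : V, ∀ y, ⟪u, y⟫_ℂ = f y :=
    ⟨(InnerProductSpace.toDual ℂ V).symm (LinearMap.toContinuousLinearMap f), fun y => by simp⟩
  set k := f v with hk
  -- Since `f` takes the value `k` on all directions of `C` at `r`, adding `k * ⟪r, ·⟫` makes it
  -- constant on `C`; this is the forbidden hyperplane.
  have he : ∀ y, ⟪u + conj k • r, y⟫_ℂ = f y + k * ⟪r, y⟫_ℂ := fun y => by
    rw [inner_add_left, inner_smul_left, hu, Complex.conj_conj]
  have he0 : u + conj k • r ≠ 0 := by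
    intro h0
    have := he w
    rw [h0, inner_zero_left, hw] at this
    refine hf ?_
    rw [map_sub, ← hk]
    linear_combination -this
  obtain ⟨p, hpC, hp⟩ := hspan _ he0 (f r + k)
  refine hp ?_
  rw [he]
  by_cases hpr : p = r
  · rw [hpr, hrr, mul_one]
  obtain ⟨a, ha, hpa⟩ := exists_chainDirection hr (by simpa using hsub hpC) hpr
  have haD := mem_chainDirections_of_mem hC hr hrC hpC hpr ha hpa
  have haN : a - v ∈ N := by
    rw [hN, mem_chainDirectionSubmodule, add_sub_cancel]
    exact haD
  have hfa : f a = k := by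
    have := hfN haN
    rw [LinearMap.mem_ker, map_sub, ← hk] at this
    exact sub_eq_zero.1 this
  have hfp : f p = f r + (1 - ⟪r, p⟫_ℂ) * k := by
    conv_lhs => rw [hpa]
    rw [map_add, map_smul, hfa, smul_eq_mul]
  rw [hfp]
  ring

end InnerProduct

/-! ### Contact points of a minimal ellipsoid -/

theorem one_add_div_pow_lt {n : ℕ} (hn : 0 < n) {t : ℝ} (ht : 0 < t) (ht' : t ≤ 1 / 2) :
    (1 + t / (2 * n)) ^ n < 1 + t := by
  have hn' : (0 : ℝ) < n := by exact_mod_cast hn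
  have h1 : (1 + t / (2 * n)) ^ n ≤ Real.exp (t / 2) := by
    calc (1 + t / (2 * n)) ^ n ≤ Real.exp (t / (2 * n)) ^ n := by
          gcongr
          linarith [Real.add_one_le_exp (t / (2 * n))]
      _ = Real.exp (t / 2) := by
          rw [← Real.exp_nat_mul]
          congr 1
          field_simp
  have h2 : 1 - t / 2 ≤ Real.exp (-(t / 2)) := by linarith [Real.add_one_le_exp (-(t / 2))]
  have h3 : Real.exp (t / 2) * Real.exp (-(t / 2)) = 1 := by
    rw [← Real.exp_add, add_neg_cancel, Real.exp_zero]
  have h4 : Real.exp (t / 2) * (1 - t / 2) ≤ 1 :=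
    (mul_le_mul_of_nonneg_left h2 (Real.exp_pos _).le).trans_eq h3
  refine h1.trans_lt ?_
  by_contra! h
  nlinarith

/-- Completing the square: the two sides differ by `t / (1 + t) * ‖h‖ ^ 2`. -/
theorem norm_mul_sub_sq_le {t κ : ℝ} (ht : 0 ≤ t) (hκ : 0 < κ) (hκt : κ ^ 2 = 1 + t) (y h : ℂ) :
    ‖(κ : ℂ) * y - ((t / κ : ℝ) : ℂ) * h‖ ^ 2 ≤ ‖y‖ ^ 2 + t * ‖y - h‖ ^ 2 := by
  have key : ∀ a b : ℝ, (κ * a - t / κ * b) ^ 2 ≤ a ^ 2 + t * (a - b) ^ 2 := by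
    intro a b
    have h1 : t / κ * κ = t := div_mul_cancel₀ _ hκ.ne'
    have h2 : (t / κ) ^ 2 * (1 + t) = t ^ 2 := by rw [← hκt, ← mul_pow, h1]
    have h3 : (t / κ) ^ 2 ≤ t := by
      have : 0 ≤ (t / κ) ^ 2 := sq_nonneg _
      by_contra! hlt
      nlinarith
    have h4 : (κ * a - t / κ * b) ^ 2 = (1 + t) * a ^ 2 - 2 * t * a * b + (t / κ) ^ 2 * b ^ 2 := by
      linear_combination a ^ 2 * hκt - 2 * a * b * h1
    rw [h4]
    nlinarith [mul_le_mul_of_nonneg_right h3 (sq_nonneg b)]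
  rw [← Complex.normSq_eq_norm_sq, ← Complex.normSq_eq_norm_sq, ← Complex.normSq_eq_norm_sq]
  simp only [Complex.normSq_apply, Complex.sub_re, Complex.sub_im, Complex.re_ofReal_mul,
    Complex.im_ofReal_mul]
  linarith [key y.re h.re, key y.im h.im]

section InnerProduct

variable {V : Type*} [NormedAddCommGroup V] [InnerProductSpace ℂ V]

theorem norm_add_smul_unit_sq {e : V} (he : ‖e‖ = 1) (x : V) (z : ℂ) :
    ‖x + z • e‖ ^ 2 = ‖x‖ ^ 2 - ‖⟪e, x⟫_ℂ‖ ^ 2 + ‖⟪e, x⟫_ℂ + z‖ ^ 2 := by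
  rw [norm_add_sq (𝕜 := ℂ), inner_smul_right, norm_smul, he, ← inner_conj_symm x e,
    ← Complex.normSq_eq_norm_sq ⟪e, x⟫_ℂ, ← Complex.normSq_eq_norm_sq (⟪e, x⟫_ℂ + z), mul_one,
    ← Complex.normSq_eq_norm_sq z]
  simp only [Complex.normSq_apply, RCLike.re_to_complex, Complex.mul_re, Complex.conj_re,
    Complex.conj_im, Complex.add_re, Complex.add_im]
  ring

/-- Among the ellipsoids `{x | ‖T x - a‖ ≤ 1}` containing `K`, the unit ball has least volume. -/
def UnitBallIsMinimal (K : Set V) : Prop :=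
  ∀ (T : V →L[ℂ] V) (a : V), (∀ x ∈ K, ‖T x - a‖ ≤ 1) → ‖T.det‖ ≤ 1

/-- Where `⟪e, x⟫` is close to `h` the added term is at most `t * ε`. The rest of `K` is compact and
has no contact points, so its norms stay below a bound less than 1, leaving room for a small `t`. -/
theorem exists_norm_sq_add_mul_le {K : Set V} (hK : IsCompact K) (hsub : K ⊆ closedBall 0 1)
    {e : V} (he : ‖e‖ = 1) {h : ℂ} (hcon : ∀ p ∈ K, ‖p‖ = 1 → ⟪e, p⟫_ℂ = h) {ε : ℝ} (hε : 0 < ε) :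
    ∃ t : ℝ, 0 < t ∧ t ≤ 1 / 2 ∧ ∀ x ∈ K, ‖x‖ ^ 2 + t * ‖⟪e, x⟫_ℂ - h‖ ^ 2 ≤ 1 + t * ε := by
  have hle : ∀ x ∈ K, ‖x‖ ≤ 1 := fun x hx => by simpa using hsub hx
  have hle2 : ∀ x ∈ K, ‖x‖ ^ 2 ≤ 1 := fun x hx => by
    simpa using pow_le_pow_left₀ (norm_nonneg x) (hle x hx) 2
  set K' : Set V := K ∩ {x | ε ≤ ‖⟪e, x⟫_ℂ - h‖ ^ 2} with hK'
  have hK'c : IsCompact K' := hK.inter_right (isClosed_le (by fun_prop) (by fun_prop))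
  suffices ∃ t : ℝ, 0 < t ∧ t ≤ 1 / 2 ∧ ∀ x ∈ K', ‖x‖ ^ 2 + t * ‖⟪e, x⟫_ℂ - h‖ ^ 2 ≤ 1 by
    obtain ⟨t, ht, ht', hx'⟩ := this
    refine ⟨t, ht, ht', fun x hx => ?_⟩
    by_cases hxε : ε ≤ ‖⟪e, x⟫_ℂ - h‖ ^ 2
    · have : 0 ≤ t * ε := by positivity
      linarith [hx' x ⟨hx, hxε⟩]
    · have : t * ‖⟪e, x⟫_ℂ - h‖ ^ 2 ≤ t * ε := by
        gcongr
        exact (not_le.1 hxε).le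
      linarith [hle2 x hx]
  rcases K'.eq_empty_or_nonempty with hemp | hne
  · exact ⟨1 / 2, by norm_num, le_rfl, by simp [hemp]⟩
  obtain ⟨x₀, hx₀, hmax⟩ := hK'c.exists_isMaxOn hne (f := fun x => ‖x‖ ^ 2) (by fun_prop)
  have hlt : ‖x₀‖ ^ 2 < 1 := by
    refine lt_of_le_of_ne (hle2 _ hx₀.1) fun h1 => ?_
    have h2 : ε ≤ ‖⟪e, x₀⟫_ℂ - h‖ ^ 2 := hx₀.2
    rw [hcon x₀ hx₀.1 ((pow_eq_one_iff_of_nonneg (norm_nonneg _) two_ne_zero).1 h1)] at h2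
    simp at h2
    linarith
  set R : ℝ := (1 + ‖h‖) ^ 2 with hR
  have hRpos : 0 < R := by positivity
  refine ⟨min (1 / 2) ((1 - ‖x₀‖ ^ 2) / R), by
    refine lt_min (by norm_num) (div_pos (by linarith) hRpos), min_le_left _ _, fun x hx => ?_⟩
  have h1 : ‖x‖ ^ 2 ≤ ‖x₀‖ ^ 2 := hmax hx
  have h2 : ‖⟪e, x⟫_ℂ - h‖ ^ 2 ≤ R := by
    rw [hR]
    gcongr
    refine (norm_sub_le _ _).trans ?_
    gcongr
    refine (norm_inner_le_norm _ _).trans ?_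
    rw [he, one_mul]
    exact hle x hx.1
  have h3 : min (1 / 2) ((1 - ‖x₀‖ ^ 2) / R) * ‖⟪e, x⟫_ℂ - h‖ ^ 2 ≤ (1 - ‖x₀‖ ^ 2) / R * R :=
    mul_le_mul (min_le_right _ _) h2 (by positivity)
      (div_nonneg (by linarith) hRpos.le)
  rw [div_mul_cancel₀ _ hRpos.ne'] at h3
  linarith

variable [FiniteDimensional ℂ V]

/-- The contact points with a minimal ellipsoid do not lie in a complex affine hyperplane. -/
theorem UnitBallIsMinimal.exists_contact {K : Set V} (hmin : UnitBallIsMinimal K)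
    (hK : IsCompact K) (hsub : K ⊆ closedBall 0 1) {e : V} (he : e ≠ 0) (h : ℂ) :
    ∃ p ∈ K ∩ sphere 0 1, ⟪e, p⟫_ℂ ≠ h := by
  wlog he1 : ‖e‖ = 1 generalizing e h
  · have hen : (‖e‖ : ℂ) ≠ 0 := by simpa using he
    obtain ⟨p, hp, hne⟩ := this (e := ((‖e‖ : ℂ)⁻¹) • e) (smul_ne_zero (inv_ne_zero hen) he)
      ((‖e‖ : ℂ)⁻¹ * h) (by
        rw [norm_smul, norm_inv, Complex.norm_real, norm_norm]
        exact inv_mul_cancel₀ (norm_ne_zero_iff.2 he))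
    refine ⟨p, hp, fun heq => hne ?_⟩
    rw [inner_smul_left, heq, map_inv₀, Complex.conj_ofReal]
  by_contra! hcon
  have hn : 0 < Module.finrank ℂ V := Module.finrank_pos_iff_exists_ne_zero.2 ⟨e, he⟩
  set n := Module.finrank ℂ V with hn_def
  have hn' : (0 : ℝ) < n := by exact_mod_cast hn
  -- With this `ε` the stretch by `κ = √(1 + t)` along `e` needs shrinking only by `ρ = √(1 + t / (2
  -- * n))`, and `ρ ^ n < κ` makes the determinant exceed 1.
  obtain ⟨t, ht, ht', hle⟩ := exists_norm_sq_add_mul_le hK hsub he1 (h := h)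
    (fun p hp hp1 => hcon p ⟨hp, by simpa using hp1⟩) (ε := 1 / (2 * n)) (by positivity)
  have hκpos : 0 < 1 + t := by linarith
  have hρpos : 0 < 1 + t / (2 * n) := by positivity
  set κ := √(1 + t) with hκ_def
  set ρ := √(1 + t / (2 * n)) with hρ_def
  have hκ : 0 < κ := Real.sqrt_pos.2 hκpos
  have hρ : 0 < ρ := Real.sqrt_pos.2 hρpos
  have hκ2 : κ ^ 2 = 1 + t := Real.sq_sqrt hκpos.le
  have hρ2 : ρ ^ 2 = 1 + t / (2 * n) := Real.sq_sqrt hρpos.le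
  set f : V →ₗ[ℂ] ℂ := (κ - 1 : ℂ) • (innerSL ℂ e).toLinearMap with hf
  set T : V →L[ℂ] V := LinearMap.toContinuousLinearMap
    ((ρ : ℂ)⁻¹ • LinearMap.transvection f e) with hT
  have hTx : ∀ x, T x = (ρ : ℂ)⁻¹ • (x + ((κ - 1) * ⟪e, x⟫_ℂ) • e) := fun x => by
    simp [hT, hf, LinearMap.transvection.apply]
  have hdet : T.det = (ρ : ℂ)⁻¹ ^ n * κ := by
    have h1 : T.det = LinearMap.det ((ρ : ℂ)⁻¹ • LinearMap.transvection f e) := rfl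
    have h2 : f e = κ - 1 := by
      simp [hf, he1]
    rw [h1, LinearMap.det_smul, LinearMap.transvection.det, h2]
    ring
  have hT1 := hmin T ((ρ : ℂ)⁻¹ • ((((t / κ : ℝ) : ℂ) * h) • e)) fun x hx => by
    rw [hTx, ← smul_sub, norm_smul, norm_inv, Complex.norm_real, Real.norm_of_nonneg hρ.le,
      inv_mul_le_iff₀ hρ, mul_one, ← sq_le_sq₀ (norm_nonneg _) hρ.le, hρ2, add_sub_assoc,
      ← sub_smul, norm_add_smul_unit_sq he1]
    have h1 := norm_mul_sub_sq_le ht.le hκ hκ2 ⟪e, x⟫_ℂ h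
    rw [show ⟪e, x⟫_ℂ + ((κ - 1) * ⟪e, x⟫_ℂ - ((t / κ : ℝ) : ℂ) * h)
      = (κ : ℂ) * ⟪e, x⟫_ℂ - ((t / κ : ℝ) : ℂ) * h by ring]
    have h2 := hle x hx
    rw [mul_one_div] at h2
    linarith
  rw [hdet, norm_mul, norm_pow, norm_inv, Complex.norm_real, Complex.norm_real,
    Real.norm_of_nonneg hρ.le, Real.norm_of_nonneg hκ.le, inv_pow,
    inv_mul_le_iff₀ (by positivity), mul_one] at hT1
  have h1 : κ ^ 2 ≤ (ρ ^ 2) ^ n := by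
    rw [← pow_mul, mul_comm, pow_mul]
    gcongr
  rw [hκ2, hρ2] at h1
  exact absurd (one_add_div_pow_lt hn ht ht') (not_lt.2 h1)

theorem HasDiskSections.eq_closedBall [Nontrivial V] {K : Set V} (hsec : HasDiskSections K)
    (hK : IsCompact K) (hconv : Convex ℝ K) (hsub : K ⊆ closedBall 0 1)
    (hmin : UnitBallIsMinimal K) : K = closedBall 0 1 := by
  have hspan := fun (e : V) (he : e ≠ 0) (k : ℂ) => hmin.exists_contact hK hsub he k
  have hC : IsChainClosed (K ∩ sphere 0 1) := fun p hp q hq z hz =>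
    ⟨hsec.mem_of_norm_eq_one hsub hp.1 (by simpa using hp.2) hq.1 (by simpa using hq.2) hz,
      by simpa using hz⟩
  -- A nonzero `e` is needed only to produce one contact point.
  obtain ⟨e, he⟩ := exists_ne (0 : V)
  obtain ⟨p, hp, -⟩ := hspan e he 0
  have hS := hC.sphere_subset Set.inter_subset_right hspan ⟨p, hp⟩
  refine hsub.antisymm ?_
  rw [← convexHull_sphere_eq_closedBall (0 : V) zero_le_one]
  exact convexHull_min (hS.trans Set.inter_subset_left) hconv

end InnerProduct

/-! ### Existence of a minimal ellipsoid and reduction to the unit ball -/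

section InnerProduct

variable {V : Type*} [NormedAddCommGroup V] [InnerProductSpace ℂ V]

theorem AffineEquiv.map_add_smul_sub (g : V ≃ᵃ[ℂ] V) (p q : V) (z : ℂ) :
    g (p + z • (q - p)) = g p + z • (g q - g p) := by
  have := g.apply_lineMap p q z
  rwa [AffineMap.lineMap_apply_module', AffineMap.lineMap_apply_module', add_comm,
    add_comm _ (g p)] at this

theorem HasDiskSections.image {K : Set V} (h : HasDiskSections K) (g : V ≃ᵃ[ℂ] V) :
    HasDiskSections (g '' K) := by
  rintro _ ⟨p, hp, rfl⟩ _ ⟨q, hq, rfl⟩ hpq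
  obtain ⟨l, ρ, hlρ⟩ := h p hp q hq fun h => hpq (h ▸ rfl)
  refine ⟨l, ρ, fun z => ?_⟩
  rw [← g.map_add_smul_sub, g.injective.mem_set_image, hlρ]

theorem hasDiskSections_closedBall (c : V) (r : ℝ) : HasDiskSections (closedBall c r) := by
  intro p hp q _ hpq
  obtain ⟨l, ρ, h, -⟩ := exists_norm_add_smul_le_iff (sub_ne_zero.2 (Ne.symm hpq))
    (mem_closedBall_iff_norm.1 hp)
  refine ⟨l, ρ, fun z => ?_⟩
  rw [← h, mem_closedBall_iff_norm, add_sub_right_comm]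

variable [FiniteDimensional ℂ V]

/-- A compact set with nonempty interior lies in an ellipsoid of minimal volume. -/
theorem exists_minimal_ellipsoid {K : Set V} (hK : IsCompact K) (hint : (interior K).Nonempty) :
    ∃ (T : V →L[ℂ] V) (a : V), T.det ≠ 0 ∧ (∀ x ∈ K, ‖T x - a‖ ≤ 1) ∧
      ∀ (T' : V →L[ℂ] V) (a' : V), (∀ x ∈ K, ‖T' x - a'‖ ≤ 1) → ‖T'.det‖ ≤ ‖T.det‖ := by
  obtain ⟨c, hc⟩ := hint
  obtain ⟨r, hr, hball⟩ := nhds_basis_closedBall.mem_iff.1 (mem_interior_iff_mem_nhds.1 hc)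
  obtain ⟨R, hRpos, hR⟩ := hK.isBounded.subset_closedBall_lt 0 0
  have hcK : c ∈ K := hball (mem_closedBall_self hr.le)
  -- Volume is least where `‖det T‖` is greatest. Singular `T` are admitted to keep `S` closed;
  -- comparison with a multiple of the identity excludes them at the maximum.
  set S : Set ((V →L[ℂ] V) × V) := {x | ∀ y ∈ K, ‖x.1 y - x.2‖ ≤ 1} with hS
  have hclosed : IsClosed S := by
    simp only [hS, Set.ofPred_forall]
    exact isClosed_iInter fun y => isClosed_iInter fun _ =>
      isClosed_le (by fun_prop) continuous_const
  have hbdd : S ⊆ closedBall 0 (2 / r) ×ˢ closedBall 0 (1 + 2 / r * ‖c‖) := by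
    rintro ⟨T, a⟩ h
    -- `K` contains a ball of radius `r`, and `T` sends differences of points of `K` to vectors of
    -- norm at most 2.
    have hT : ‖T‖ ≤ 2 / r := by
      refine ContinuousLinearMap.opNorm_le_of_unit_norm (by positivity) fun z hz => ?_
      have h1 := h c hcK
      have h2 := h (c + (r : ℂ) • z) (hball (by simp [norm_smul, hz, abs_of_pos hr]))
      have h3 : ‖(r : ℂ) • T z‖ ≤ 2 := by
        have : (r : ℂ) • T z = (T (c + (r : ℂ) • z) - a) - (T c - a) := by
          rw [map_add, map_smul]
          abel
        rw [this]
        exact (norm_sub_le _ _).trans (by linarith)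
      rw [norm_smul, Complex.norm_real, Real.norm_of_nonneg hr.le] at h3
      rwa [le_div_iff₀' hr]
    refine ⟨by simpa using hT, ?_⟩
    have h1 : ‖T c - a‖ ≤ 1 := h c hcK
    have h2 : ‖T c‖ ≤ 2 / r * ‖c‖ := T.le_of_opNorm_le hT c
    have h3 : ‖a‖ ≤ ‖T c - a‖ + ‖T c‖ := by
      rw [norm_sub_rev]
      exact norm_le_norm_sub_add a (T c)
    simp only [mem_closedBall_zero_iff]
    linarith
  have : ProperSpace V := FiniteDimensional.proper ℂ V
  have : ProperSpace (V →L[ℂ] V) := FiniteDimensional.proper ℂ _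
  have hcomp : IsCompact S :=
    ((isCompact_closedBall _ _).prod (isCompact_closedBall _ _)).of_isClosed_subset hclosed hbdd
  have hmem : (((R : ℂ)⁻¹ • ContinuousLinearMap.id ℂ V, 0) : (V →L[ℂ] V) × V) ∈ S := by
    intro y hy
    have : ‖y‖ ≤ R := by simpa using hR hy
    simp only [_root_.smul_apply, ContinuousLinearMap.id_apply, sub_zero, norm_smul,
      norm_inv, Complex.norm_real, Real.norm_of_nonneg hRpos.le]
    rwa [inv_mul_le_iff₀ hRpos, mul_one]
  obtain ⟨⟨T, a⟩, hTa, hmax⟩ := hcomp.exists_isMaxOn ⟨_, hmem⟩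
    (f := fun x => ‖x.1.det‖)
    (ContinuousLinearMap.continuous_det.comp continuous_fst).norm.continuousOn
  have hmax' : ∀ (T' : V →L[ℂ] V) (a' : V), (∀ x ∈ K, ‖T' x - a'‖ ≤ 1) → ‖T'.det‖ ≤ ‖T.det‖ :=
    fun T' a' h => hmax (show (T', a') ∈ S from h)
  refine ⟨T, a, fun h0 => ?_, hTa, hmax'⟩
  have h1 := hmax' _ _ hmem
  have h2 : ((R : ℂ)⁻¹ • ContinuousLinearMap.id ℂ V).det = (R : ℂ)⁻¹ ^ Module.finrank ℂ V := by
    have : ((R : ℂ)⁻¹ • ContinuousLinearMap.id ℂ V).det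
        = LinearMap.det ((R : ℂ)⁻¹ • (LinearMap.id : V →ₗ[ℂ] V)) := rfl
    rw [this, LinearMap.det_smul, LinearMap.det_id, mul_one]
  rw [h0, norm_zero, h2, norm_le_zero_iff] at h1
  exact pow_ne_zero _ (inv_ne_zero (by exact_mod_cast hRpos.ne')) h1

theorem HasDiskSections.exists_affineEquiv [Nontrivial V] {K : Set V} (hsec : HasDiskSections K)
    (hK : IsCompact K) (hconv : Convex ℝ K) (hint : (interior K).Nonempty) :
    ∃ g : V ≃ᵃ[ℂ] V, K = g '' closedBall 0 1 := by
  obtain ⟨T, a, hdet, hTa, hmax⟩ := exists_minimal_ellipsoid hK hint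
  have hdet' : LinearMap.det (T : V →ₗ[ℂ] V) ≠ 0 := hdet
  set g : V ≃ᵃ[ℂ] V := ((T : V →ₗ[ℂ] V).equivOfDetNeZero hdet').toAffineEquiv.trans
    (AffineEquiv.constVAdd ℂ V (-a)) with hg
  have hgx : ∀ x, g x = T x - a := fun x => by
    have : g x = -a + T x := rfl
    rw [this]
    abel
  have hgcont : Continuous g := by
    rw [show (g : V → V) = fun x => T x - a from funext hgx]
    fun_prop
  have hgconv : Convex ℝ (g '' K) := by
    have := (hconv.linear_image ((T : V →ₗ[ℂ] V).restrictScalars ℝ)).translate (-a)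
    rw [Set.image_image] at this
    rwa [show (g : V → V) = fun x => -a + (T : V →ₗ[ℂ] V).restrictScalars ℝ x from
      funext fun x => (hgx x).trans (sub_eq_neg_add _ _)]
  have hsub : g '' K ⊆ closedBall 0 1 := by
    rintro _ ⟨x, hx, rfl⟩
    rw [mem_closedBall_zero_iff, hgx]
    exact hTa x hx
  have hmin : UnitBallIsMinimal (g '' K) := by
    intro T' a' h
    -- An ellipsoid around `g '' K` pulls back to one around `K`, and determinants multiply.
    have h1 := hmax (T'.comp T) (T' a + a') fun x hx => by
      have := h (g x) ⟨x, hx, rfl⟩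
      rwa [hgx, map_sub, sub_sub] at this
    have h2 : (T'.comp T).det = T'.det * T.det := LinearMap.det_comp _ _
    rw [h2, norm_mul] at h1
    exact le_of_mul_le_mul_right (by rwa [one_mul]) (norm_pos_iff.2 hdet)
  have heq := (hsec.image g).eq_closedBall (hK.image hgcont) hgconv hsub hmin
  exact ⟨g.symm, by rw [← heq, Set.image_image]; simp⟩

end InnerProduct

/-! ### Complex lines as affine subspaces, and the main theorem -/

theorem mem_iff_of_finrank_direction_eq_one {V : Type*} [AddCommGroup V] [Module ℂ V]
    {L : AffineSubspace ℂ V} (hL : Module.finrank ℂ L.direction = 1) {p q : V} (hp : p ∈ L)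
    (hq : q ∈ L) (hpq : p ≠ q) {x : V} : x ∈ L ↔ ∃ z : ℂ, p + z • (q - p) = x := by
  have hd : q - p ∈ L.direction := L.vsub_mem_direction hq hp
  constructor
  · intro hx
    obtain ⟨z, hz⟩ := (finrank_eq_one_iff_of_nonzero' (⟨q - p, hd⟩ : L.direction)
      (by simpa [Subtype.ext_iff, sub_eq_zero] using Ne.symm hpq)).1 hL
      ⟨x - p, L.vsub_mem_direction hx hp⟩
    have hz' : z • (q - p) = x - p := congrArg Subtype.val hz
    exact ⟨z, by rw [hz', add_sub_cancel]⟩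
  · rintro ⟨z, rfl⟩
    rw [add_comm]
    exact L.vadd_mem_of_mem_direction (L.direction.smul_mem z hd) hp

/-- The parametrisation `z ↦ p + z • (q - p)` of a line scales distances by `‖q - p‖`, so disks in
the parameter correspond to disks in the line. -/
theorem hasDiskSections_iff {n : ℕ} {K : Set (EuclideanSpace ℂ (Fin n))} :
    HasDiskSections K ↔ ∀ L : AffineSubspace ℂ (EuclideanSpace ℂ (Fin n)), IsComplexLine L →
      ((L : Set (EuclideanSpace ℂ (Fin n))) ∩ K = ∅ ∨
        (∃ p, (L : Set (EuclideanSpace ℂ (Fin n))) ∩ K = {p}) ∨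
        IsDiskIn L ((L : Set (EuclideanSpace ℂ (Fin n))) ∩ K)) := by
  constructor
  · intro h L hL
    rcases Set.eq_empty_or_nonempty ((L : Set (EuclideanSpace ℂ (Fin n))) ∩ K) with h0 | hne
    · exact Or.inl h0
    rcases hne.exists_eq_singleton_or_nontrivial with h1 | ⟨p, hp, q, hq, hpq⟩
    · exact Or.inr (Or.inl h1)
    right; right
    obtain ⟨l, ρ, hlρ⟩ := h p hp.2 q hq.2 hpq
    have hd : 0 < ‖q - p‖ := norm_pos_iff.2 (sub_ne_zero.2 hpq.symm)
    have hmem := fun x => mem_iff_of_finrank_direction_eq_one hL hp.1 hq.1 hpq (x := x)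
    have h0 : dist 0 l ≤ ρ := (hlρ 0).1 (by simpa using hp.2)
    have h1 : dist 1 l ≤ ρ := (hlρ 1).1 (by simpa using hq.2)
    -- The parameters 0 and 1 both lie in the disk, so its diameter is at least 1.
    have hρ : 0 < ρ := by
      have h2 := dist_triangle_right (0 : ℂ) 1 l
      rw [dist_zero_left, norm_one] at h2
      linarith
    refine ⟨p + l • (q - p), (hmem _).2 ⟨l, rfl⟩, ρ * ‖q - p‖, by positivity, ?_⟩
    ext x
    refine and_congr_right fun hx => ?_
    obtain ⟨z, rfl⟩ := (hmem x).1 hx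
    rw [hlρ, dist_add_left, dist_eq_norm (z • _), ← sub_smul, norm_smul, ← dist_eq_norm,
      mul_le_mul_iff_left₀ hd]
  · intro h p hp q hq hpq
    have hd : 0 < ‖q - p‖ := norm_pos_iff.2 (sub_ne_zero.2 hpq.symm)
    set L : AffineSubspace ℂ (EuclideanSpace ℂ (Fin n)) :=
      AffineSubspace.mk' p (Submodule.span ℂ {q - p}) with hLdef
    have hL : IsComplexLine L := by
      rw [IsComplexLine, hLdef, AffineSubspace.direction_mk']
      exact finrank_span_singleton (sub_ne_zero.2 hpq.symm)
    have hpL : p ∈ L := AffineSubspace.self_mem_mk' _ _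
    have hqL : q ∈ L := AffineSubspace.mem_mk'.2 (Submodule.mem_span_singleton_self _)
    have hmem := fun x => mem_iff_of_finrank_direction_eq_one hL hpL hqL hpq (x := x)
    have hpLK : p ∈ (L : Set (EuclideanSpace ℂ (Fin n))) ∩ K := ⟨hpL, hp⟩
    have hqLK : q ∈ (L : Set (EuclideanSpace ℂ (Fin n))) ∩ K := ⟨hqL, hq⟩
    rcases h L hL with h0 | ⟨x, hx⟩ | ⟨c, hc, r, -, hD⟩
    · rw [h0] at hpLK
      exact hpLK.elim
    · rw [hx] at hpLK hqLK
      exact absurd (hpLK.trans hqLK.symm) hpq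
    · obtain ⟨l, rfl⟩ := (hmem c).1 hc
      refine ⟨l, r / ‖q - p‖, fun z => ?_⟩
      have hz : p + z • (q - p) ∈ L := (hmem _).2 ⟨z, rfl⟩
      have := Set.ext_iff.1 hD (p + z • (q - p))
      simp only [Set.mem_inter_iff, SetLike.mem_coe, hz, true_and, Set.mem_ofPred_eq] at this
      rw [this, dist_add_left, dist_eq_norm (z • _), ← sub_smul, norm_smul, ← dist_eq_norm,
        le_div_iff₀ hd]

theorem mainTheorem2 (n : ℕ) (K : ConvexBody (EuclideanSpace ℂ (Fin n)))
    (hK : (interior (K : Set (EuclideanSpace ℂ (Fin n)))).Nonempty) :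
    IsComplexEllipsoid (K : Set (EuclideanSpace ℂ (Fin n))) ↔
      ∀ L : AffineSubspace ℂ (EuclideanSpace ℂ (Fin n)), IsComplexLine L →
        ((L : Set (EuclideanSpace ℂ (Fin n))) ∩ (K : Set (EuclideanSpace ℂ (Fin n))) = ∅ ∨
          (∃ p, (L : Set (EuclideanSpace ℂ (Fin n))) ∩
            (K : Set (EuclideanSpace ℂ (Fin n))) = {p}) ∨
          IsDiskIn L ((L : Set (EuclideanSpace ℂ (Fin n))) ∩
            (K : Set (EuclideanSpace ℂ (Fin n))))) := by
  rw [← hasDiskSections_iff]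
  constructor
  · rintro ⟨f, c, r, -, h⟩
    rw [h]
    exact (hasDiskSections_closedBall c r).image f
  · intro h
    -- For `n = 0` the space is a point, and every nonempty subset is the whole of it.
    cases subsingleton_or_nontrivial (EuclideanSpace ℂ (Fin n))
    · refine ⟨AffineEquiv.refl ℂ _, 0, 1, one_pos, ?_⟩
      rw [(hK.mono interior_subset).eq_univ,
        ((nonempty_closedBall.2 zero_le_one).image _).eq_univ]
    · obtain ⟨g, hg⟩ := h.exists_affineEquiv K.isCompact K.convex hK
      exact ⟨g, 0, 1, one_pos, hg⟩
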